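/- Let $n\ge 2$, $k\ge 1$, and let $C_1,\dots,C_k\subset\mathbb H^n$ be non-empty, connected, closed (compact, without boundary), embedded hypersurfaces of class $C^r$ for some $r\ge 1$ (for instance, smooth ones) such that the bounded domains of $\mathbb H^n$ whose boundaries are the $C_j$ are pairwise disjoint. Put $S=C_1\cup\dots\cup C_k$. Assume that for every complete geodesic $\gamma\subset\mathbb H^n$ there exists a totally geodesic hyperplane $\pi_\gamma\subset\mathbb H^n$ which is orthogonal to $\gamma$ and which is a hyperplane of symmetry of $S$, that is, the reflection of $\mathbb H^n$ across $\pi_\gamma$ maps $S$ onto itself. Then $S$ is a geodesic sphere of $\mathbb H^n$: there are a point $c\in\mathbb H^n$ and a number $\rho>0$ with $S=\{x\in\mathbb H^n : d_{\mathbb H^n}(c,x)=\rho\}$. -/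

import Mathlib

namespace Hyperbolic

/-- The Minkowski (Lorentzian) bilinear form `-x₀y₀ + x₁y₁ + ⋯ + xₙyₙ` on `ℝⁿ⁺¹`. -/
def mink {n : ℕ} (x y : Fin (n + 1) → ℝ) : ℝ :=
  -(x 0 * y 0) + ∑ i : Fin n, x i.succ * y i.succ

/-- Hyperbolic space `ℍⁿ`: the upper sheet of the hyperboloid `⟨x, x⟩ = -1` in `ℝⁿ⁺¹`.
The Riemannian metric is the restriction of the Minkowski form to the tangent spaces
`T_p ℍⁿ = {v | ⟨p, v⟩ = 0}`. -/
def HyperbolicSpace (n : ℕ) : Type :=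
  {x : Fin (n + 1) → ℝ // mink x x = -1 ∧ 0 < x 0}

/-- The topology of `ℍⁿ` is the subspace topology. -/
instance (n : ℕ) : TopologicalSpace (HyperbolicSpace n) :=
  inferInstanceAs (TopologicalSpace {x : Fin (n + 1) → ℝ // mink x x = -1 ∧ 0 < x 0})

variable {n : ℕ}

theorem mink_comm (x y : Fin (n + 1) → ℝ) : mink x y = mink y x := by
  simp only [mink, mul_comm]

theorem mink_add_right (x y z : Fin (n + 1) → ℝ) : mink x (y + z) = mink x y + mink x z := by
  simp only [mink, Pi.add_apply, mul_add, Finset.sum_add_distrib]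
  ring

theorem mink_smul_right (a : ℝ) (x y : Fin (n + 1) → ℝ) : mink x (a • y) = a * mink x y := by
  simp only [mink, Pi.smul_apply, smul_eq_mul, mul_add, Finset.mul_sum]
  congr 1
  · ring
  · exact Finset.sum_congr rfl fun i _ => by ring

theorem mink_add_left (x y z : Fin (n + 1) → ℝ) : mink (x + y) z = mink x z + mink y z := by
  rw [mink_comm, mink_add_right, mink_comm z x, mink_comm z y]

theorem mink_smul_left (a : ℝ) (x y : Fin (n + 1) → ℝ) : mink (a • x) y = a * mink x y := by
  rw [mink_comm, mink_smul_right, mink_comm]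

/-- A unit timelike vector having negative product with a point of `ℍⁿ` lies on the upper sheet. -/
theorem pos_of_mink_neg (p : HyperbolicSpace n) (q : Fin (n + 1) → ℝ)
    (hq : mink q q = -1) (hpq : mink p.1 q < 0) : 0 < q 0 := by
  by_contra! h
  have hp := p.2.1
  have hp0 := p.2.2
  have cs := Finset.sum_mul_sq_le_sq_mul_sq Finset.univ
    (fun i : Fin n => p.1 i.succ) (fun i : Fin n => q i.succ)
  simp only [mink] at hp hq hpq
  have e1 : ∑ i : Fin n, p.1 i.succ ^ 2 = p.1 0 ^ 2 - 1 := by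
    simp only [pow_two]; linarith
  have e2 : ∑ i : Fin n, q i.succ ^ 2 = q 0 ^ 2 - 1 := by
    simp only [pow_two]; linarith
  rw [e1, e2] at cs
  have e3 : 0 ≤ ∑ i : Fin n, p.1 i.succ ^ 2 := Finset.sum_nonneg fun i _ => sq_nonneg _
  have e4 : 0 ≤ ∑ i : Fin n, q i.succ ^ 2 := Finset.sum_nonneg fun i _ => sq_nonneg _
  rw [e1] at e3
  rw [e2] at e4
  have e5 : 0 ≤ -(p.1 0 * q 0) := by nlinarith
  nlinarith

/-- The hyperbolic distance: `cosh d(x, y) = -⟨x, y⟩`. -/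
noncomputable def hdist (x y : HyperbolicSpace n) : ℝ :=
  Real.arcosh (-mink x.1 y.1)

/-- The geodesic sphere of centre `c` and radius `ρ`. -/
def geodesicSphere (c : HyperbolicSpace n) (ρ : ℝ) : Set (HyperbolicSpace n) :=
  {x | hdist c x = ρ}

/-- `u` is a unit tangent vector of `ℍⁿ` at `p`. -/
def IsUnitTangent (p : HyperbolicSpace n) (u : Fin (n + 1) → ℝ) : Prop :=
  mink p.1 u = 0 ∧ mink u u = 1

/-- The unit speed geodesic through `p` with initial velocity `u`. -/
noncomputable def geodesic (p : HyperbolicSpace n) (u : Fin (n + 1) → ℝ)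
    (hu : IsUnitTangent p u) (t : ℝ) : HyperbolicSpace n :=
  ⟨Real.cosh t • p.1 + Real.sinh t • u, by
    have h1 : mink (Real.cosh t • p.1 + Real.sinh t • u)
        (Real.cosh t • p.1 + Real.sinh t • u) = -1 := by
      simp only [mink_add_left, mink_add_right, mink_smul_left, mink_smul_right, p.2.1,
        mink_comm u p.1, hu.1, hu.2]
      linarith [Real.cosh_sq t]
    refine ⟨h1, pos_of_mink_neg p _ h1 ?_⟩
    simp only [mink_add_right, mink_smul_right, p.2.1, hu.1]
    linarith [Real.cosh_pos t]⟩

/-- A (complete) geodesic of `ℍⁿ`, as a subset. -/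
def IsGeodesic (γ : Set (HyperbolicSpace n)) : Prop :=
  ∃ (p : HyperbolicSpace n) (u : Fin (n + 1) → ℝ) (hu : IsUnitTangent p u),
    γ = Set.range (geodesic p u hu)

/-- The totally geodesic hyperplane of `ℍⁿ` with unit normal `v`. -/
def hyperplane (v : Fin (n + 1) → ℝ) : Set (HyperbolicSpace n) :=
  {x | mink x.1 v = 0}

/-- A totally geodesic hyperplane of `ℍⁿ`: the intersection of `ℍⁿ` with the Minkowski orthogonal
complement of a unit spacelike vector. -/
def IsGeodesicHyperplane (π : Set (HyperbolicSpace n)) : Prop :=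
  ∃ v : Fin (n + 1) → ℝ, mink v v = 1 ∧ π = hyperplane v

/-- The reflection of `ℍⁿ` across the totally geodesic hyperplane with unit normal `v`. -/
noncomputable def reflection (v : Fin (n + 1) → ℝ) (hv : mink v v = 1)
    (x : HyperbolicSpace n) : HyperbolicSpace n :=
  ⟨x.1 + (-(2 * mink x.1 v)) • v, by
    have h1 : mink (x.1 + (-(2 * mink x.1 v)) • v) (x.1 + (-(2 * mink x.1 v)) • v) = -1 := by
      simp only [mink_add_left, mink_add_right, mink_smul_left, mink_smul_right, x.2.1,
        mink_comm v x.1, hv]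
      ring
    refine ⟨h1, pos_of_mink_neg x _ h1 ?_⟩
    simp only [mink_add_right, mink_smul_right, x.2.1]
    nlinarith [sq_nonneg (mink x.1 v)]⟩

/-- `π` is a (totally geodesic) hyperplane of symmetry of `S`: the reflection across `π`
maps `S` onto itself. -/
def IsPlaneOfSymmetry (π S : Set (HyperbolicSpace n)) : Prop :=
  ∃ (v : Fin (n + 1) → ℝ) (hv : mink v v = 1), π = hyperplane v ∧ reflection v hv '' S = S

/-- The hyperplane `π` is orthogonal to the geodesic `γ`: they meet at a point `p` where the
velocity `u` of `γ` is orthogonal to the velocity of every geodesic through `p` lying in `π`. -/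
def IsOrthogonal (π γ : Set (HyperbolicSpace n)) : Prop :=
  ∃ (p : HyperbolicSpace n) (u : Fin (n + 1) → ℝ) (hu : IsUnitTangent p u),
    p ∈ π ∧ γ = Set.range (geodesic p u hu) ∧
      ∀ (w : Fin (n + 1) → ℝ) (hw : IsUnitTangent p w),
        Set.range (geodesic p w hw) ⊆ π → mink u w = 0

/-- `C` is an embedded hypersurface (an embedded `(n-1)`-submanifold without boundary) of class
`C^r` of `ℍⁿ`: near each of its points `p` it is the zero set of a `C^r` function whose
differential at `p` does not vanish on the tangent space `T_p ℍⁿ`. -/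
def IsEmbeddedHypersurface (r : WithTop ℕ∞) (C : Set (HyperbolicSpace n)) : Prop :=
  ∀ p ∈ C, ∃ (U : Set (Fin (n + 1) → ℝ)) (f : (Fin (n + 1) → ℝ) → ℝ),
    IsOpen U ∧ p.1 ∈ U ∧ ContDiffOn ℝ r f U ∧
      (∀ x : HyperbolicSpace n, x.1 ∈ U → (x ∈ C ↔ f x.1 = 0)) ∧
      ∃ v : Fin (n + 1) → ℝ, mink p.1 v = 0 ∧ fderiv ℝ f p.1 v ≠ 0

/-- `D` is a bounded domain (a bounded, non-empty, connected open set) of `ℍⁿ` whose boundary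
is `C`. For a compact connected embedded hypersurface `C` there is exactly one such `D`. -/
def IsBoundedDomainOf (D C : Set (HyperbolicSpace n)) : Prop :=
  IsOpen D ∧ IsConnected D ∧
    (∃ (c : HyperbolicSpace n) (R : ℝ), ∀ x ∈ D, hdist c x ≤ R) ∧ frontier D = C

end Hyperbolic

namespace Hyperbolic

open Filter Topology

variable {n : ℕ}

/-! The symmetries of `S` have a common centre. Reflections of hyperbolic space are linear on
`ℝⁿ⁺¹`, so those preserving `S` preserve the compact convex set `K`, the closed convex hull of `S`.
A minimiser of `⟨z, z⟩` on `K` must lie on every mirror, since otherwise the midpoint of `z` and its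
image would do better. Rescaled to the hyperboloid, it is the centre `c` (`exists_center`).

For a geodesic through `c` with velocity `u`, the given orthogonal mirror passes through `c`, so its
normal is `±u`. Hence every reflection fixing `c` preserves `S`, and since these act transitively on
each sphere about `c`, `S` is a union of such spheres (`exists_center_saturated`).

A `C¹` hypersurface has empty interior, hence so does `S`. If the distance to `c` varied on some `C
j`, `S` would contain an open shell; so each `C j` lies in one sphere (`height_eq_of_mem`). By
transversality it is open in that sphere, and it is closed, so it is the whole sphere
(`eq_sphere_of_subset_sphere`). Two concentric spheres would bound balls that both contain `c`, so
disjointness leaves only one. -/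

theorem mink_neg_right (x y : Fin (n + 1) → ℝ) : mink x (-y) = -mink x y := by
  rw [← neg_one_smul ℝ y, mink_smul_right, neg_one_mul]

theorem mink_neg_left (x y : Fin (n + 1) → ℝ) : mink (-x) y = -mink x y := by
  rw [mink_comm, mink_neg_right, mink_comm]

theorem mink_sub_right (x y z : Fin (n + 1) → ℝ) : mink x (y - z) = mink x y - mink x z := by
  rw [sub_eq_add_neg, mink_add_right, mink_neg_right, sub_eq_add_neg]

theorem mink_sub_left (x y z : Fin (n + 1) → ℝ) : mink (x - y) z = mink x z - mink y z := by
  rw [mink_comm, mink_sub_right, mink_comm z x, mink_comm z y]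

theorem mink_zero_right (x : Fin (n + 1) → ℝ) : mink x 0 = 0 := by simp [mink]

theorem continuous_mink :
    Continuous fun x : (Fin (n + 1) → ℝ) × (Fin (n + 1) → ℝ) => mink x.1 x.2 := by
  unfold mink; fun_prop

theorem _root_.Continuous.mink {X : Type*} [TopologicalSpace X] {f g : X → Fin (n + 1) → ℝ}
    (hf : Continuous f) (hg : Continuous g) : Continuous fun x => mink (f x) (g x) :=
  continuous_mink.comp (hf.prodMk hg)

/-- The Minkowski form as a linear functional of its second argument. -/
def minkLinear (x : Fin (n + 1) → ℝ) : (Fin (n + 1) → ℝ) →ₗ[ℝ] ℝ where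
  toFun := mink x
  map_add' := mink_add_right x
  map_smul' a y := mink_smul_right a x y

theorem continuous_val : Continuous fun x : HyperbolicSpace n => x.1 :=
  continuous_subtype_val

theorem HyperbolicSpace.ext {x y : HyperbolicSpace n} (h : x.1 = y.1) : x = y :=
  Subtype.ext h

/-! ### Positivity of the Minkowski form on tangent spaces -/

theorem one_le_coord_zero (x : HyperbolicSpace n) : 1 ≤ x.1 0 := by
  have h := x.2.1
  have h0 := x.2.2
  have h1 : 0 ≤ ∑ i : Fin n, x.1 i.succ * x.1 i.succ :=
    Finset.sum_nonneg fun i _ => mul_self_nonneg _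
  simp only [mink] at h
  nlinarith

/-- The Minkowski form is positive definite on tangent spaces. -/
theorem mink_self_pos (p : HyperbolicSpace n) {v : Fin (n + 1) → ℝ} (hv : mink p.1 v = 0)
    (h0 : v ≠ 0) : 0 < mink v v := by
  have hp := p.2.1
  have hp0 := p.2.2
  have cs := Finset.sum_mul_sq_le_sq_mul_sq Finset.univ
    (fun i : Fin n => p.1 i.succ) (fun i : Fin n => v i.succ)
  simp only [mink] at hp hv ⊢
  have e1 : ∑ i : Fin n, p.1 i.succ ^ 2 = p.1 0 ^ 2 - 1 := by
    simp only [pow_two]; linarith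
  have e2 : ∑ i : Fin n, p.1 i.succ * v i.succ = p.1 0 * v 0 := by linarith
  have e3 : ∑ i : Fin n, v i.succ * v i.succ = ∑ i : Fin n, v i.succ ^ 2 := by
    simp only [pow_two]
  have e4 : 0 ≤ ∑ i : Fin n, v i.succ ^ 2 := Finset.sum_nonneg fun i _ => sq_nonneg _
  rw [e1, e2] at cs
  rw [e3]
  rcases e4.eq_or_lt with h | h
  · exfalso
    rw [← h, mul_zero] at cs
    have hv0 : p.1 0 * v 0 = 0 := by nlinarith
    have hv0' : v 0 = 0 := by simpa [hp0.ne'] using hv0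
    have hs := (Finset.sum_eq_zero_iff_of_nonneg fun i _ => sq_nonneg (v (Fin.succ i))).1 h.symm
    refine h0 (funext fun i => ?_)
    refine Fin.cases hv0' (fun j => ?_) i
    simpa using hs j (Finset.mem_univ j)
  · have hpp : 0 < p.1 0 ^ 2 := by positivity
    have : 0 < p.1 0 ^ 2 * (-(v 0 * v 0) + ∑ i : Fin n, v i.succ ^ 2) := by nlinarith
    exact (pos_iff_pos_of_mul_pos this).1 hpp

theorem mink_self_nonneg (p : HyperbolicSpace n) {v : Fin (n + 1) → ℝ} (hv : mink p.1 v = 0) :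
    0 ≤ mink v v := by
  by_cases h : v = 0
  · simp [h, mink_zero_right]
  · exact (mink_self_pos p hv h).le

/-- Nonzero tangent vectors are positive multiples of unit ones. -/
theorem exists_unit_smul (p : HyperbolicSpace n) {v : Fin (n + 1) → ℝ} (hv : mink p.1 v = 0)
    (h0 : v ≠ 0) : ∃ (b : ℝ) (e : Fin (n + 1) → ℝ), 0 < b ∧ v = b • e ∧ IsUnitTangent p e := by
  have h := mink_self_pos p hv h0
  have hb := Real.sqrt_pos.2 h
  refine ⟨√(mink v v), (√(mink v v))⁻¹ • v, hb, ?_, ?_, ?_⟩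
  · rw [smul_smul, mul_inv_cancel₀ hb.ne', one_smul]
  · rw [mink_smul_right, hv, mul_zero]
  · rw [mink_smul_right, mink_smul_left, ← mul_assoc, ← mul_inv, Real.mul_self_sqrt h.le,
      inv_mul_cancel₀ h.ne']

/-- Two linear conditions on `ℝⁿ⁺¹` have a nonzero common solution once `n ≥ 2`. The hypothesis on
the dimension enters only here. The vector `u` need not be tangent at `p`. -/
theorem exists_unit_orthogonal (hn : 2 ≤ n) (p : HyperbolicSpace n) (u : Fin (n + 1) → ℝ) :
    ∃ e, IsUnitTangent p e ∧ mink u e = 0 := by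
  have hker : LinearMap.ker ((minkLinear p.1).prod (minkLinear u)) ≠ ⊥ :=
    LinearMap.ker_ne_bot_of_finrank_lt (by simp; omega)
  obtain ⟨v, hv, h0⟩ := (Submodule.ne_bot_iff _).1 hker
  have hv' : mink p.1 v = 0 ∧ mink u v = 0 := by
    simpa [minkLinear] using hv
  obtain ⟨b, e, hb, rfl, he⟩ := exists_unit_smul p hv'.1 h0
  refine ⟨e, he, ?_⟩
  simpa [mink_smul_right, hb.ne'] using hv'.2

/-! ### Distance to a centre and polar coordinates -/

/-- `cosh` of the distance to `c`. -/
def height (c x : HyperbolicSpace n) : ℝ := -mink c.1 x.1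

theorem continuous_height (c : HyperbolicSpace n) : Continuous (height c) :=
  (continuous_const.mink continuous_val).neg

theorem height_self (c : HyperbolicSpace n) : height c c = 1 := by
  simp [height, c.2.1]

theorem mink_sub_height_smul (c x : HyperbolicSpace n) :
    mink c.1 (x.1 - height c x • c.1) = 0 := by
  simp only [mink_sub_right, mink_smul_right, c.2.1, height]; ring

theorem mink_self_sub_height_smul (c x : HyperbolicSpace n) :
    mink (x.1 - height c x • c.1) (x.1 - height c x • c.1) = height c x ^ 2 - 1 := by
  simp only [mink_sub_right, mink_sub_left, mink_smul_right, mink_smul_left, c.2.1, x.2.1, height,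
    mink_comm x.1 c.1]; ring

/-- The part of `x` orthogonal to `c` is spacelike with square `height c x ^ 2 - 1`, and the value
cannot be `≤ -1` because `-x` would then lie on the upper sheet. -/
theorem one_le_height (c x : HyperbolicSpace n) : 1 ≤ height c x := by
  have h := mink_self_nonneg c (mink_sub_height_smul c x)
  rw [mink_self_sub_height_smul] at h
  by_contra! hlt
  have hneg : height c x ≤ -1 := by nlinarith
  have := pos_of_mink_neg c (-x.1) (by simp [mink_neg_left, mink_neg_right, x.2.1])
    (by rw [mink_neg_right]; change height c x < 0; linarith)
  have h0 := x.2.2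
  simp only [Pi.neg_apply] at this
  linarith

theorem eq_of_height_eq_one {c x : HyperbolicSpace n} (h : height c x = 1) : x = c := by
  by_contra hne
  have hz : x.1 - height c x • c.1 ≠ 0 := by
    rw [h, one_smul, sub_ne_zero]
    exact fun hh => hne (HyperbolicSpace.ext hh)
  have := mink_self_pos c (mink_sub_height_smul c x) hz
  rw [mink_self_sub_height_smul, h] at this
  norm_num at this

/-- Polar decomposition of a point with respect to a centre. -/
theorem exists_polar (hn : 2 ≤ n) (c x : HyperbolicSpace n) : ∃ w, ∃ hw : IsUnitTangent c w,
    geodesic c w hw (Real.arcosh (height c x)) = x := by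
  have h1 := one_le_height c x
  by_cases h0 : x.1 - height c x • c.1 = 0
  · obtain ⟨w, hw, -⟩ := exists_unit_orthogonal hn c 0
    refine ⟨w, hw, HyperbolicSpace.ext ?_⟩
    have h2 := mink_self_sub_height_smul c x
    rw [h0, mink_zero_right] at h2
    change Real.cosh _ • c.1 + Real.sinh _ • w = x.1
    rw [Real.cosh_arcosh h1, Real.sinh_arcosh h1, ← h2, Real.sqrt_zero, zero_smul, add_zero]
    exact (sub_eq_zero.1 h0).symm
  · obtain ⟨b, w, hb, hbw, hw⟩ := exists_unit_smul c (mink_sub_height_smul c x) h0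
    refine ⟨w, hw, HyperbolicSpace.ext ?_⟩
    have h2 := mink_self_sub_height_smul c x
    rw [hbw, mink_smul_left, mink_smul_right, hw.2] at h2
    change Real.cosh _ • c.1 + Real.sinh _ • w = x.1
    rw [Real.cosh_arcosh h1, Real.sinh_arcosh h1, ← h2,
      show b * (b * 1) = b ^ 2 by ring, Real.sqrt_sq hb.le, ← hbw]
    abel

theorem height_geodesic (c p : HyperbolicSpace n) {u : Fin (n + 1) → ℝ} (hu : IsUnitTangent p u)
    (t : ℝ) : height c (geodesic p u hu t) =
      Real.cosh t * height c p - Real.sinh t * mink c.1 u := by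
  simp only [height, geodesic, mink_add_right, mink_smul_right]; ring

theorem height_geodesic_self (c : HyperbolicSpace n) {u : Fin (n + 1) → ℝ}
    (hu : IsUnitTangent c u) (t : ℝ) : height c (geodesic c u hu t) = Real.cosh t := by
  rw [height_geodesic, height_self, hu.1]; ring

theorem geodesic_zero (p : HyperbolicSpace n) {u : Fin (n + 1) → ℝ} (hu : IsUnitTangent p u) :
    geodesic p u hu 0 = p :=
  HyperbolicSpace.ext (by simp [geodesic])

/-- Geodesics depend continuously on the initial data. -/
theorem continuous_geodesic {X : Type*} [TopologicalSpace X] {p : X → HyperbolicSpace n}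
    {u : X → Fin (n + 1) → ℝ} (hu : ∀ x, IsUnitTangent (p x) (u x)) {t : X → ℝ}
    (hp : Continuous p) (huc : Continuous u) (ht : Continuous t) :
    Continuous fun x => geodesic (p x) (u x) (hu x) (t x) := by
  refine Continuous.subtype_mk (f := fun x => Real.cosh (t x) • (p x).1 + Real.sinh (t x) • u x) ?_ _
  exact ((Real.continuous_cosh.comp ht).smul (continuous_val.comp hp)).add
    ((Real.continuous_sinh.comp ht).smul huc)

theorem hasDerivAt_geodesic_zero (p : HyperbolicSpace n) {u : Fin (n + 1) → ℝ}
    (hu : IsUnitTangent p u) : HasDerivAt (fun t => (geodesic p u hu t).1) u 0 := by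
  have h := ((Real.hasDerivAt_cosh 0).smul_const p.1).add ((Real.hasDerivAt_sinh 0).smul_const u)
  simpa [geodesic] using! h

/-! ### The centre of symmetry -/

/-- A non-empty compact set has a centre lying on all its hyperplanes of symmetry. -/
theorem exists_center {S : Set (HyperbolicSpace n)} (hS : IsCompact S) (hne : S.Nonempty) :
    ∃ c : HyperbolicSpace n, ∀ (v : Fin (n + 1) → ℝ) (hv : mink v v = 1),
      reflection v hv '' S = S → mink c.1 v = 0 := by
  set T : Set (Fin (n + 1) → ℝ) := (fun x : HyperbolicSpace n => x.1) '' S with hT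
  have hTc : IsCompact T := hS.image continuous_val
  set K := closure (convexHull ℝ T) with hK
  have hconv : Convex ℝ K := (convex_convexHull ℝ T).closure
  have hKc : IsCompact K :=
    Metric.isCompact_of_isClosed_isBounded isClosed_closure
      (isBounded_convexHull.2 hTc.isBounded).closure
  have hTK : T ⊆ K := (subset_convexHull ℝ T).trans subset_closure
  have hhalf : ∀ z ∈ K, 1 ≤ z 0 := by
    have hcl : IsClosed {z : Fin (n + 1) → ℝ | 1 ≤ z 0} :=
      isClosed_le continuous_const (continuous_apply 0)
    have hcv : Convex ℝ {z : Fin (n + 1) → ℝ | 1 ≤ z 0} :=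
      convex_halfSpace_ge (IsLinearMap.mk (fun _ _ => rfl) fun _ _ => rfl) 1
    refine closure_minimal (convexHull_min ?_ hcv) hcl
    rintro _ ⟨x, -, rfl⟩
    exact one_le_coord_zero x
  obtain ⟨s, hs⟩ := hne
  obtain ⟨z, hzK, hz⟩ := hKc.exists_isMinOn ⟨s.1, hTK ⟨s, hs, rfl⟩⟩
    (continuous_id.mink continuous_id).continuousOn
  have hmin : ∀ y ∈ K, mink z z ≤ mink y y := fun y hy => hz hy
  -- Points of `S` have square `-1`, so the minimiser is timelike and can be rescaled to the
  -- hyperboloid; `hhalf` puts it on the upper sheet.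
  have hz1 : 1 ≤ -mink z z := by
    have := hmin s.1 (hTK ⟨s, hs, rfl⟩)
    rw [s.2.1] at this
    linarith
  have hpos : 0 < √(-mink z z) := Real.sqrt_pos.2 (by linarith)
  refine ⟨⟨(√(-mink z z))⁻¹ • z, ?_, ?_⟩, fun v hv hvS => ?_⟩
  · have h2 := Real.mul_self_sqrt (show 0 ≤ -mink z z by linarith)
    rw [mink_smul_right, mink_smul_left, ← mul_assoc, ← mul_inv, h2, inv_neg, neg_mul,
      inv_mul_cancel₀ (by linarith)]
  · have := hhalf z hzK
    rw [Pi.smul_apply, smul_eq_mul]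
    positivity
  -- The linear extension of the reflection, which therefore commutes with taking convex hulls.
  set R : (Fin (n + 1) → ℝ) →ₗ[ℝ] (Fin (n + 1) → ℝ) :=
    LinearMap.id - (2 : ℝ) • (minkLinear v).smulRight v with hR
  have hRx : ∀ x, R x = x + (-(2 * mink x v)) • v := fun x => by
    simp [hR, minkLinear, mink_comm v x, smul_smul, sub_eq_add_neg]
  have hRT : Set.MapsTo R T T := by
    rintro _ ⟨x, hx, rfl⟩
    refine ⟨reflection v hv x, ?_, ?_⟩
    · rw [← hvS]; exact ⟨x, hx, rfl⟩
    · rw [hRx]; rfl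
  have hRK : Set.MapsTo R K K := by
    refine Set.MapsTo.closure ?_ R.continuous_of_finiteDimensional
    rw [Set.mapsTo_iff_image_subset, R.image_convexHull]
    exact convexHull_mono hRT.image_subset
  -- The midpoint of `z` and `R z` is `z - ⟨z, v⟩ v`, of square `⟨z, z⟩ - ⟨z, v⟩²`; minimality
  -- forces `⟨z, v⟩ = 0`.
  have hmid := hmin _ (hconv hzK (hRK hzK) (by norm_num : (0 : ℝ) ≤ 1 / 2)
    (by norm_num : (0 : ℝ) ≤ 1 / 2) (by norm_num))
  rw [hRx] at hmid
  simp only [mink_add_left, mink_add_right, mink_smul_left, mink_smul_right, mink_comm v z, hv]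
    at hmid
  have h0 : mink z v = 0 := by
    have : mink z v ^ 2 ≤ 0 := by nlinarith
    exact pow_eq_zero_iff two_ne_zero |>.1 (le_antisymm this (sq_nonneg _))
  change mink ((√(-mink z z))⁻¹ • z) v = 0
  rw [mink_smul_left, h0, mul_zero]

/-! ### Reflections through the centre -/

/-- A geodesic through `p` lies in a hyperplane through `p` as soon as it is tangent to it. -/
theorem range_geodesic_subset_hyperplane {p : HyperbolicSpace n} {v w : Fin (n + 1) → ℝ}
    (hw : IsUnitTangent p w) (hp : mink p.1 v = 0) (hwv : mink w v = 0) :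
    Set.range (geodesic p w hw) ⊆ hyperplane v := by
  rintro _ ⟨t, rfl⟩
  change mink (Real.cosh t • p.1 + Real.sinh t • w) v = 0
  rw [mink_add_left, mink_smul_left, mink_smul_left, hp, hwv, mul_zero, mul_zero, add_zero]

/-- The normal of a hyperplane through `c` orthogonal to a geodesic through `c` is the
velocity of the geodesic, up to sign. -/
theorem exists_eq_smul_of_isOrthogonal {c : HyperbolicSpace n} {u v : Fin (n + 1) → ℝ}
    (hu : IsUnitTangent c u) (hv : mink v v = 1) (hcv : mink c.1 v = 0)
    (h : IsOrthogonal (hyperplane v) (Set.range (geodesic c u hu))) : ∃ a : ℝ, u = a • v := by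
  obtain ⟨p, u', hu', hp, hγ, hort⟩ := h
  replace hp : mink p.1 v = 0 := hp
  -- Otherwise the part of `u'` orthogonal to `v` is the direction of a geodesic inside the
  -- hyperplane that is not orthogonal to `u'`.
  have hu'v : u' = mink u' v • v := by
    by_contra hne
    have hw0 : mink p.1 (u' - mink u' v • v) = 0 := by
      rw [mink_sub_right, mink_smul_right, hu'.1, hp]; ring
    obtain ⟨b, e, hb, hbe, he⟩ := exists_unit_smul p hw0 (sub_ne_zero.2 hne)
    have hev : mink e v = 0 := by
      have h1 : b * mink e v = 0 := by
        rw [← mink_smul_left, ← hbe, mink_sub_left, mink_smul_left, hv]; ring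
      exact (mul_eq_zero.1 h1).resolve_left hb.ne'
    have h2 := hort e he (range_geodesic_subset_hyperplane he hp hev)
    have h3 : b * mink e e = 0 := by
      rw [← mink_smul_left, ← hbe, mink_sub_left, mink_smul_left, h2, mink_comm v e, hev]; ring
    rw [he.2] at h3
    linarith
  have hcoef : mink u' v ≠ 0 := by
    intro h0
    have h1 := hu'.2
    rw [hu'v, h0, zero_smul, mink_zero_right] at h1
    norm_num at h1
  -- The geodesic crosses the hyperplane only at `t = 0`, and `c` lies on both.
  have hcp : c = p := by
    obtain ⟨t, ht⟩ : c ∈ Set.range (geodesic p u' hu') := hγ ▸ ⟨0, geodesic_zero c hu⟩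
    have h1 : mink (geodesic p u' hu' t).1 v = 0 := by rw [ht]; exact hcv
    simp only [geodesic, mink_add_left, mink_smul_left, hp, mul_zero, zero_add] at h1
    have h2 : t = 0 := Real.sinh_eq_zero.1 ((mul_eq_zero.1 h1).resolve_right hcoef)
    rw [← ht, h2, geodesic_zero]
  subst hcp
  -- Both parametrisations now start at `c`. Pairing the point at time `1` with `c` gives `cosh t =
  -- cosh 1`, hence `sinh t • u' = sinh 1 • u`.
  obtain ⟨t, ht⟩ : geodesic c u hu 1 ∈ Set.range (geodesic c u' hu') := hγ ▸ ⟨1, rfl⟩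
  have hval : Real.cosh t • c.1 + Real.sinh t • u' = Real.cosh 1 • c.1 + Real.sinh 1 • u :=
    congrArg Subtype.val ht
  have hcosh : Real.cosh t = Real.cosh 1 := by
    have := congrArg (mink c.1) hval
    simp only [mink_add_right, mink_smul_right, hu.1, hu'.1, c.2.1] at this
    linarith
  rw [hcosh, add_right_inj] at hval
  have hs : Real.sinh 1 ≠ 0 := (Real.sinh_pos_iff.2 one_pos).ne'
  refine ⟨(Real.sinh 1)⁻¹ * (Real.sinh t * mink u' v), ?_⟩
  rw [mul_smul, mul_smul, ← hu'v, hval, smul_smul, inv_mul_cancel₀ hs, one_smul]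

/-- Points at the same distance from `c` are exchanged by a reflection fixing `c`. -/
theorem mem_of_height_eq {S : Set (HyperbolicSpace n)} {c : HyperbolicSpace n}
    (hS : ∀ (u : Fin (n + 1) → ℝ) (hu : IsUnitTangent c u), reflection u hu.2 '' S = S)
    {x y : HyperbolicSpace n} (hx : x ∈ S) (h : height c x = height c y) : y ∈ S := by
  by_cases hxy : x.1 = y.1
  · rwa [← HyperbolicSpace.ext hxy]
  -- Equal heights mean that the perpendicular bisector of `x` and `y`, with normal `x - y`, passes
  -- through `c`.
  have h0 : mink c.1 (x.1 - y.1) = 0 := by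
    rw [mink_sub_right]; unfold height at h; linarith
  obtain ⟨b, e, hb, hbe, he⟩ := exists_unit_smul c h0 (sub_ne_zero.2 hxy)
  rw [← hS e he]
  refine ⟨x, hx, HyperbolicSpace.ext ?_⟩
  have hy : y.1 = x.1 - b • e := by rw [← hbe]; abel
  have h1 := y.2.1
  rw [hy] at h1
  simp only [mink_sub_left, mink_sub_right, mink_smul_left, mink_smul_right, x.2.1, he.2,
    mink_comm e x.1] at h1
  have h2 : 2 * mink x.1 e = b := by
    have : b * (b - 2 * mink x.1 e) = 0 := by linarith
    linarith [(mul_eq_zero.1 this).resolve_left hb.ne']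
  change x.1 + (-(2 * mink x.1 e)) • e = y.1
  rw [h2, hy, neg_smul, sub_eq_add_neg]

/-- Both normals are unit, so `a = ±1`, and the reflection is quadratic in its normal. -/
theorem reflection_eq_of_eq_smul {u v : Fin (n + 1) → ℝ} {a : ℝ} (hv : mink v v = 1)
    (hu : mink u u = 1) (h : u = a • v) : reflection u hu = reflection v hv := by
  subst h
  have ha : a * a = 1 := by
    simpa [mink_smul_left, mink_smul_right, hv] using hu
  funext x
  refine HyperbolicSpace.ext ?_
  change x.1 + (-(2 * mink x.1 (a • v))) • a • v = x.1 + (-(2 * mink x.1 v)) • v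
  rw [smul_smul, mink_smul_right]
  congr 2
  linear_combination -2 * mink x.1 v * ha

/-- If every geodesic has an orthogonal hyperplane of symmetry of the compact set `S`, then `S` is
a union of spheres about some point. -/
theorem exists_center_saturated {S : Set (HyperbolicSpace n)} (hS : IsCompact S)
    (hne : S.Nonempty)
    (hsym : ∀ γ : Set (HyperbolicSpace n), IsGeodesic γ → ∃ π : Set (HyperbolicSpace n),
      IsGeodesicHyperplane π ∧ IsOrthogonal π γ ∧ IsPlaneOfSymmetry π S) :
    ∃ c : HyperbolicSpace n, ∀ x ∈ S, ∀ y, height c x = height c y → y ∈ S := by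
  obtain ⟨c, hc⟩ := exists_center hS hne
  refine ⟨c, fun x hx y => mem_of_height_eq (fun u hu => ?_) hx⟩
  obtain ⟨π, -, hort, v, hv, rfl, hvS⟩ := hsym _ ⟨c, u, hu, rfl⟩
  obtain ⟨a, ha⟩ := exists_eq_smul_of_isOrthogonal hu hv (hc v hv hvS) hort
  rw [reflection_eq_of_eq_smul hv hu.2 ha, hvS]

/-! ### Transversal crossing and empty interior -/

/-- A function with nonzero derivative changes sign. -/
theorem exists_sign_change {g : ℝ → ℝ} {d : ℝ} (hg : HasDerivAt g d 0) (hd : d ≠ 0)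
    (h0 : g 0 = 0) : ∀ᶠ s in 𝓝[>] (0 : ℝ), g s * g (-s) < 0 := by
  have h1 : Tendsto (fun s => s⁻¹ * g s) (𝓝[≠] 0) (𝓝 d) := by
    simpa [slope_fun_def, h0] using! hasDerivAt_iff_tendsto_slope.1 hg
  have hr : Tendsto (fun s : ℝ => s) (𝓝[>] 0) (𝓝[≠] 0) :=
    tendsto_id.mono_left (nhdsWithin_mono _ fun s (hs : 0 < s) => hs.ne')
  have hl : Tendsto (fun s : ℝ => -s) (𝓝[>] 0) (𝓝[≠] 0) := by
    refine tendsto_nhdsWithin_of_tendsto_nhds_of_eventually_within _ ?_ ?_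
    · simpa using (continuous_neg.tendsto (0 : ℝ)).mono_left nhdsWithin_le_nhds
    · filter_upwards [self_mem_nhdsWithin] with s hs
      exact neg_ne_zero.2 (ne_of_gt hs)
  -- The difference quotients at `s` and `-s` both tend to `d`, so their product is eventually
  -- positive; it equals `-s⁻² g(s) g(-s)`.
  have h2 := (h1.comp hr).mul (h1.comp hl)
  have h3 : 0 < d * d := mul_self_pos.2 hd
  filter_upwards [h2.eventually (lt_mem_nhds h3), self_mem_nhdsWithin] with s hs hs0
  have hs0 : 0 < s := hs0
  simp only [Function.comp_apply, inv_neg] at hs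
  have h4 : s⁻¹ * g s * (-s⁻¹ * g (-s)) = -((s⁻¹) ^ 2 * (g s * g (-s))) := by ring
  rw [h4] at hs
  have h5 : 0 < (s⁻¹) ^ 2 := by positivity
  by_contra! h
  have := mul_nonneg h5.le h
  linarith

/-- Curves close to a curve crossing a hypersurface transversally meet the hypersurface. -/
theorem eventually_exists_mem {r : WithTop ℕ∞} (hr : 1 ≤ r) {C : Set (HyperbolicSpace n)}
    {p : HyperbolicSpace n} {U : Set (Fin (n + 1) → ℝ)} {f : (Fin (n + 1) → ℝ) → ℝ}
    (hU : IsOpen U) (hpU : p.1 ∈ U) (hf : ContDiffOn ℝ r f U) (hpC : p ∈ C)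
    (hC : ∀ x : HyperbolicSpace n, x.1 ∈ U → (x ∈ C ↔ f x.1 = 0))
    {X : Type*} [TopologicalSpace X] {x₀ : X} {ψ : X × ℝ → HyperbolicSpace n}
    (hψ : Continuous ψ) (h0 : ψ (x₀, 0) = p) {v : Fin (n + 1) → ℝ}
    (hv : HasDerivAt (fun s => (ψ (x₀, s)).1) v 0) (hfv : fderiv ℝ f p.1 v ≠ 0)
    {ε : ℝ} (hε : 0 < ε) : ∀ᶠ x in 𝓝 x₀, ∃ s, |s| < ε ∧ ψ (x, s) ∈ C := by
  have hfd : DifferentiableAt ℝ f p.1 :=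
    (hf.contDiffAt (hU.mem_nhds hpU)).differentiableAt (by
      rintro rfl; simp at hr)
  have hg : HasDerivAt (fun s => f (ψ (x₀, s)).1) (fderiv ℝ f p.1 v) 0 := by
    have h1 : HasFDerivAt f (fderiv ℝ f p.1) (ψ (x₀, 0)).1 := by
      rw [h0]; exact hfd.hasFDerivAt
    exact h1.comp_hasDerivAt 0 hv
  have hψv : Continuous fun y => (ψ y).1 := continuous_val.comp hψ
  have hUψ : IsOpen {y | (ψ y).1 ∈ U} := hU.preimage hψv
  have hmem : {y | (ψ y).1 ∈ U} ∈ 𝓝 (x₀, (0 : ℝ)) := hUψ.mem_nhds (by simpa [h0] using! hpU)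
  obtain ⟨V, hV, W, hW, hVW⟩ := mem_nhds_prod_iff.1 hmem
  obtain ⟨δ, hδ, hδW⟩ := Metric.mem_nhds_iff.1 hW
  have hsm : ∀ᶠ s in 𝓝[>] (0 : ℝ), s < min δ ε :=
    nhdsWithin_le_nhds (gt_mem_nhds (lt_min hδ hε))
  obtain ⟨s, ⟨hsign, hs⟩, hs0⟩ := ((exists_sign_change hg hfv (by
    simpa [h0] using (hC p hpU).1 hpC)).and hsm |>.and self_mem_nhdsWithin).exists
  have hs0 : 0 < s := hs0
  have hin : ∀ x ∈ V, ∀ t ∈ Set.Icc (-s) s, (ψ (x, t)).1 ∈ U := fun x hx t ht => by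
    refine hVW (Set.mk_mem_prod hx (hδW ?_))
    rw [Metric.mem_ball, Real.dist_eq, sub_zero, abs_lt]
    have := (lt_min_iff.1 hs).1
    constructor <;> linarith [ht.1, ht.2]
  have hcont : ∀ t ∈ Set.Icc (-s) s, ContinuousAt (fun x => f (ψ (x, t)).1) x₀ := fun t ht => by
    have h1 : ContinuousAt f (ψ (x₀, t)).1 :=
      (hf.contDiffAt (hU.mem_nhds (hin x₀ (mem_of_mem_nhds hV) t ht))).continuousAt
    exact ContinuousAt.comp (f := fun x => (ψ (x, t)).1) h1
      (hψv.comp (continuous_id.prodMk continuous_const)).continuousAt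
  -- The opposite signs of `f` at the ends `±s` persist for parameters near `x₀`; the intermediate
  -- value theorem then gives a zero on each nearby curve.
  have hprod := ((hcont s ⟨by linarith, le_rfl⟩).mul (hcont (-s) ⟨le_rfl, by linarith⟩)).eventually
    (gt_mem_nhds hsign)
  filter_upwards [hprod, hV] with x hx hxV
  have hfc : ContinuousOn (fun t => f (ψ (x, t)).1) (Set.Icc (-s) s) := fun t ht => by
    have h1 : ContinuousAt f (ψ (x, t)).1 :=
      (hf.contDiffAt (hU.mem_nhds (hin x hxV t ht))).continuousAt
    exact (ContinuousAt.comp (f := fun t => (ψ (x, t)).1) h1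
      (hψv.comp (continuous_const.prodMk continuous_id)).continuousAt).continuousWithinAt
  have hle : -s ≤ s := by linarith
  obtain ⟨t, ht, htz⟩ : (0 : ℝ) ∈ (fun t => f (ψ (x, t)).1) '' Set.Icc (-s) s := by
    rcases mul_neg_iff.1 hx with h | h
    · exact intermediate_value_Icc hle hfc ⟨h.2.le, h.1.le⟩
    · exact intermediate_value_Icc' hle hfc ⟨h.1.le, h.2.le⟩
  refine ⟨t, ?_, (hC _ (hin x hxV t ht)).2 htz⟩
  have := (lt_min_iff.1 hs).2
  rw [abs_lt]
  constructor <;> linarith [ht.1, ht.2]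

/-- An embedded hypersurface has empty interior. -/
theorem IsEmbeddedHypersurface.interior_eq_empty {r : WithTop ℕ∞} (hr : 1 ≤ r)
    {C : Set (HyperbolicSpace n)} (hC : IsEmbeddedHypersurface r C) : interior C = ∅ := by
  by_contra hne
  obtain ⟨p, hp⟩ := Set.nonempty_iff_ne_empty.2 hne
  obtain ⟨U, f, hU, hpU, hf, hCf, v, hpv, hfv⟩ := hC p (interior_subset hp)
  have hv0 : v ≠ 0 := by rintro rfl; simp at hfv
  obtain ⟨b, e, hb, rfl, he⟩ := exists_unit_smul p hpv hv0
  have hfe : fderiv ℝ f p.1 e ≠ 0 := fun h => hfv (by simp [h])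
  have hfd : DifferentiableAt ℝ f p.1 :=
    (hf.contDiffAt (hU.mem_nhds hpU)).differentiableAt (by
      rintro rfl; simp at hr)
  have hg : HasDerivAt (fun s => f (geodesic p e he s).1) (fderiv ℝ f p.1 e) 0 := by
    have h1 : HasFDerivAt f (fderiv ℝ f p.1) (geodesic p e he 0).1 := by
      rw [geodesic_zero]; exact hfd.hasFDerivAt
    exact h1.comp_hasDerivAt 0 (hasDerivAt_geodesic_zero p he)
  have hcont : Continuous (geodesic p e he) :=
    continuous_geodesic (fun _ => he) continuous_const continuous_const continuous_id
  -- Short pieces of the geodesic stay in the interior of `C`, where `f` vanishes and cannot change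
  -- sign.
  have hO : ∀ᶠ s in 𝓝 (0 : ℝ), geodesic p e he s ∈ interior C ∧ (geodesic p e he s).1 ∈ U := by
    refine (hcont.continuousAt.eventually ?_).and
      ((continuous_val.comp hcont).continuousAt.eventually ?_)
    · rw [geodesic_zero]; exact isOpen_interior.mem_nhds hp
    · rw [Function.comp_apply, geodesic_zero]; exact hU.mem_nhds hpU
  obtain ⟨s, hs, hsO⟩ := ((exists_sign_change hg hfe (by
    simpa [geodesic_zero] using (hCf p hpU).1 (interior_subset hp))).and
      (nhdsWithin_le_nhds hO)).exists
  rw [(hCf _ hsO.2).1 (interior_subset hsO.1), zero_mul] at hs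
  exact lt_irrefl _ hs

/-! ### Spheres and balls -/

/-- Spheres are connected. -/
theorem isPreconnected_height_eq (hn : 2 ≤ n) (c : HyperbolicSpace n) (a : ℝ) :
    IsPreconnected {x | height c x = a} := by
  refine isPreconnected_of_forall_pair fun x hx y hy => ?_
  obtain ⟨u, hu, hux⟩ := exists_polar hn c x
  obtain ⟨w, hw, hwy⟩ := exists_polar hn c y
  rw [show height c x = a from hx] at hux
  rw [show height c y = a from hy] at hwy
  -- Gram–Schmidt: `w = cos θ • u + sin θ • e`. Taking `β ≥ 0` allows `θ = arccos α`. If `w = ±u`,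
  -- any unit `e` orthogonal to `u` serves.
  obtain ⟨e, β, he, hue, hβ, hwe⟩ : ∃ (e : Fin (n + 1) → ℝ) (β : ℝ), IsUnitTangent c e ∧
      mink u e = 0 ∧ 0 ≤ β ∧ w = mink u w • u + β • e := by
    by_cases hz : w - mink u w • u = 0
    · obtain ⟨e, he, hue⟩ := exists_unit_orthogonal hn c u
      exact ⟨e, 0, he, hue, le_rfl, by rw [zero_smul, add_zero]; exact sub_eq_zero.1 hz⟩
    · have hc : mink c.1 (w - mink u w • u) = 0 := by
        rw [mink_sub_right, mink_smul_right, hw.1, hu.1]; ring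
      obtain ⟨b, e, hb, hbe, he⟩ := exists_unit_smul c hc hz
      refine ⟨e, b, he, ?_, hb.le, by rw [← hbe]; abel⟩
      have h1 : b * mink u e = 0 := by
        rw [← mink_smul_right, ← hbe, mink_sub_right, mink_smul_right, hu.2]; ring
      exact (mul_eq_zero.1 h1).resolve_left hb.ne'
  set α := mink u w
  have hαβ : α ^ 2 + β ^ 2 = 1 := by
    have h1 := hw.2
    rw [hwe] at h1
    simp only [mink_add_left, mink_add_right, mink_smul_left, mink_smul_right, hu.2, he.2,
      mink_comm e u, hue] at h1
    linarith
  have hunit : ∀ θ : ℝ, IsUnitTangent c (Real.cos θ • u + Real.sin θ • e) := fun θ => by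
    constructor
    · rw [mink_add_right, mink_smul_right, mink_smul_right, hu.1, he.1]; ring
    · simp only [mink_add_left, mink_add_right, mink_smul_left, mink_smul_right, hu.2, he.2,
        mink_comm e u, hue]
      linarith [Real.sin_sq_add_cos_sq θ]
  have hcont : Continuous fun θ : ℝ => geodesic c _ (hunit θ) (Real.arcosh a) :=
    continuous_geodesic hunit continuous_const (by fun_prop) continuous_const
  have ha : 1 ≤ a := by rw [← show height c x = a from hx]; exact one_le_height c x
  refine ⟨Set.range fun θ : ℝ => geodesic c _ (hunit θ) (Real.arcosh a), ?_, ⟨0, ?_⟩,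
    ⟨Real.arccos α, ?_⟩, isPreconnected_range hcont⟩
  · rintro _ ⟨θ, rfl⟩
    change height c (geodesic c _ (hunit θ) (Real.arcosh a)) = a
    rw [height_geodesic_self, Real.cosh_arcosh ha]
  · simp [hux]
  · have h1 : Real.cos (Real.arccos α) = α := Real.cos_arccos (by nlinarith) (by nlinarith)
    have h2 : Real.sin (Real.arccos α) = β := by
      rw [Real.sin_arccos, show 1 - α ^ 2 = β ^ 2 by linarith, Real.sqrt_sq hβ]
    simp only [h1, h2, ← hwe, hwy]

/-- The open ball `{x | height c x < a}` is a bounded domain with boundary the sphere. -/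
theorem isBoundedDomainOf_ball (hn : 2 ≤ n) (c : HyperbolicSpace n) {a : ℝ} (ha : 1 < a) :
    IsBoundedDomainOf {x | height c x < a} {x | height c x = a} := by
  have hopen : IsOpen {x | height c x < a} :=
    isOpen_lt (continuous_height c) continuous_const
  have hc : c ∈ {x | height c x < a} := by
    change height c c < a
    rwa [height_self]
  refine ⟨hopen, ⟨⟨c, hc⟩, ?_⟩, ⟨c, Real.arcosh a, fun x hx => ?_⟩, ?_⟩
  · refine isPreconnected_of_forall c fun x hx => ?_
    obtain ⟨w, hw, hwx⟩ := exists_polar hn c x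
    have h1 := one_le_height c x
    have h2 := Real.arcosh_nonneg h1
    have hcont : Continuous (geodesic c w hw) :=
      continuous_geodesic (fun _ => hw) continuous_const continuous_const continuous_id
    refine ⟨geodesic c w hw '' Set.Icc 0 (Real.arcosh (height c x)), ?_,
      ⟨0, ⟨le_rfl, h2⟩, geodesic_zero c hw⟩, ⟨_, ⟨h2, le_rfl⟩, hwx⟩,
      isPreconnected_Icc.image _ hcont.continuousOn⟩
    rintro _ ⟨t, ht, rfl⟩
    change height c _ < a
    rw [height_geodesic_self]
    refine lt_of_le_of_lt ?_ (show height c x < a from hx)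
    rw [← Real.cosh_arcosh h1, Real.cosh_le_cosh, abs_of_nonneg ht.1, abs_of_nonneg h2]
    exact ht.2
  · exact (Real.arcosh_le_arcosh (zero_lt_one.trans_le (one_le_height c x)) (by linarith)).2
      (le_of_lt hx)
  · refine subset_antisymm (frontier_lt_subset_eq (continuous_height c) continuous_const) ?_
    intro x hx
    rw [hopen.frontier_eq]
    refine ⟨?_, fun h => (ne_of_lt h) hx⟩
    obtain ⟨w, hw, hwx⟩ := exists_polar hn c x
    rw [show height c x = a from hx] at hwx
    have hρ := Real.arcosh_pos ha
    have hcont : Continuous (geodesic c w hw) :=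
      continuous_geodesic (fun _ => hw) continuous_const continuous_const continuous_id
    rw [← hwx]
    have hmem : Real.arcosh a ∈ closure (Set.Ioo 0 (Real.arcosh a)) := by
      rw [closure_Ioo hρ.ne]; exact ⟨hρ.le, le_rfl⟩
    refine map_mem_closure hcont hmem fun t ht => ?_
    change height c _ < a
    rw [height_geodesic_self, ← Real.cosh_arcosh ha.le, Real.cosh_lt_cosh, abs_of_pos ht.1,
      abs_of_pos hρ]
    exact ht.2

/-! ### Hypersurfaces inside a sphere -/

/-- A hypersurface contained in a sphere is tangent to it. -/
theorem fderiv_eq_zero_of_subset_sphere (hn : 2 ≤ n) {r : WithTop ℕ∞} (hr : 1 ≤ r)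
    {C : Set (HyperbolicSpace n)} {c p : HyperbolicSpace n} {a : ℝ}
    (hCa : ∀ x ∈ C, height c x = a) (hpC : p ∈ C)
    {U : Set (Fin (n + 1) → ℝ)} {f : (Fin (n + 1) → ℝ) → ℝ}
    (hU : IsOpen U) (hpU : p.1 ∈ U) (hf : ContDiffOn ℝ r f U)
    (hC : ∀ x : HyperbolicSpace n, x.1 ∈ U → (x ∈ C ↔ f x.1 = 0))
    {v : Fin (n + 1) → ℝ} (hpv : mink p.1 v = 0) (hcv : mink c.1 v = 0) :
    fderiv ℝ f p.1 v = 0 := by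
  by_contra hfv
  have hv0 : v ≠ 0 := by rintro rfl; simp at hfv
  obtain ⟨b, u, hb, rfl, hu⟩ := exists_unit_smul p hpv hv0
  have hfu : fderiv ℝ f p.1 u ≠ 0 := fun h => hfv (by simp [h])
  rw [mink_smul_right] at hcv
  replace hcv := (mul_eq_zero.1 hcv).resolve_left hb.ne'
  -- A direction in which to push `p` off the sphere: the sign `⟨c, ν⟩ ≤ 0` makes the height
  -- increase strictly along it.
  obtain ⟨ν, hν, huν, hcν⟩ : ∃ ν, IsUnitTangent p ν ∧ mink u ν = 0 ∧ mink c.1 ν ≤ 0 := by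
    obtain ⟨e, he, hue⟩ := exists_unit_orthogonal hn p u
    rcases le_total (mink c.1 e) 0 with h | h
    · exact ⟨e, he, hue, h⟩
    · refine ⟨-e, ⟨?_, ?_⟩, ?_, ?_⟩
      · rw [mink_neg_right, he.1, neg_zero]
      · rw [mink_neg_right, mink_neg_left, he.2, neg_neg]
      · rw [mink_neg_right, hue, neg_zero]
      · rw [mink_neg_right]; linarith
  -- Since `u` is orthogonal to `p` and `ν`, it remains tangent all along the geodesic in direction
  -- `ν`.
  have hq : ∀ y : ℝ × ℝ, IsUnitTangent (geodesic p ν hν y.1) u := fun y => by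
    refine ⟨?_, hu.2⟩
    change mink (Real.cosh y.1 • p.1 + Real.sinh y.1 • ν) u = 0
    rw [mink_add_left, mink_smul_left, mink_smul_left, hu.1, mink_comm ν u, huν]; ring
  have hψ : Continuous fun y : ℝ × ℝ => geodesic (geodesic p ν hν y.1) u (hq y) y.2 :=
    continuous_geodesic hq
      (continuous_geodesic (fun _ => hν) continuous_const continuous_const continuous_fst)
      continuous_const continuous_snd
  have hev := eventually_exists_mem hr hU hpU hf hpC hC (x₀ := (0 : ℝ)) hψ
    (by simp only [geodesic_zero]) (v := u)
    (by simpa only [geodesic_zero] using hasDerivAt_geodesic_zero p hu) hfu one_pos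
  obtain ⟨x, ⟨s, -, hs⟩, hx⟩ := ((hev.filter_mono (nhdsWithin_le_nhds (s := Set.Ioi 0))).and
    self_mem_nhdsWithin).exists
  have hx : 0 < x := hx
  -- As `⟨c, u⟩ = 0`, moving along `u` multiplies the height by `cosh s ≥ 1`. The pushed geodesic
  -- thus stays outside the sphere, yet it meets `C`.
  have h1 := hCa _ hs
  rw [height_geodesic, height_geodesic, hcv, hCa p hpC] at h1
  have ha : 1 ≤ a := hCa p hpC ▸ one_le_height c p
  have h2 := Real.one_le_cosh s
  have h3 := Real.one_lt_cosh.2 hx.ne'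
  have h4 := Real.sinh_pos_iff.2 hx
  have h5 : a < Real.cosh x * a - Real.sinh x * mink c.1 ν := by nlinarith
  nlinarith

/-- The unit tangent vector at `q` pointing to `c`. -/
theorem isUnitTangent_radial {c q : HyperbolicSpace n} {a : ℝ} (ha : 1 < a)
    (hq : height c q = a) : IsUnitTangent q ((√(a ^ 2 - 1))⁻¹ • (c.1 - a • q.1)) := by
  have h1 : 0 < a ^ 2 - 1 := by nlinarith
  have h2 : mink c.1 q.1 = -a := by rw [← hq, height, neg_neg]
  have h3 := Real.mul_self_sqrt h1.le
  have h4 := (Real.sqrt_pos.2 h1).ne'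
  constructor
  · rw [mink_smul_right, mink_sub_right, mink_smul_right, mink_comm q.1 c.1, h2, q.2.1]; ring
  · rw [mink_smul_right, mink_smul_left, ← mul_assoc, ← mul_inv, h3, inv_mul_eq_one₀ h1.ne']
    simp only [mink_sub_left, mink_sub_right, mink_smul_left, mink_smul_right, mink_comm q.1 c.1,
      h2, q.2.1, c.2.1]
    ring

/-- A compact hypersurface contained in a sphere is the whole sphere. -/
theorem eq_sphere_of_subset_sphere (hn : 2 ≤ n) {r : WithTop ℕ∞} (hr : 1 ≤ r)
    {C : Set (HyperbolicSpace n)} (hemb : IsEmbeddedHypersurface r C) (hcl : IsClosed C)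
    (hne : C.Nonempty) {c : HyperbolicSpace n} {a : ℝ} (hCa : ∀ x ∈ C, height c x = a) :
    1 < a ∧ C = {x | height c x = a} := by
  have ha : 1 < a := by
    obtain ⟨p, hp⟩ := hne
    have h1 := one_le_height c p
    rw [hCa p hp] at h1
    refine lt_of_le_of_ne h1 fun h => ?_
    have hpc : p = c := eq_of_height_eq_one (by rw [hCa p hp, ← h])
    obtain ⟨U, f, hU, hpU, hf, hC, v, hpv, hfv⟩ := hemb p hp
    exact hfv (fderiv_eq_zero_of_subset_sphere hn hr hCa hp hU hpU hf hC hpv (hpc ▸ hpv))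
  refine ⟨ha, subset_antisymm hCa ?_⟩
  have hb : 0 < √(a ^ 2 - 1) := Real.sqrt_pos.2 (by nlinarith)
  have hb2 := Real.mul_self_sqrt (show 0 ≤ a ^ 2 - 1 by nlinarith)
  set b := √(a ^ 2 - 1) with hbdef
  have hopen : IsOpen {q : {x | height c x = a} | q.1 ∈ C} := by
    refine isOpen_iff_mem_nhds.2 fun p hp => ?_
    obtain ⟨U, f, hU, hpU, hf, hC, v, hpv, hfv⟩ := hemb p.1 hp
    have hν : ∀ q : {x | height c x = a}, IsUnitTangent q.1 (b⁻¹ • (c.1 - a • q.1.1)) :=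
      fun q => isUnitTangent_radial ha q.2
    have hcν : ∀ q : {x | height c x = a}, mink c.1 (b⁻¹ • (c.1 - a • q.1.1)) = b := fun q => by
      have h2 : mink c.1 q.1.1 = -a := neg_eq_iff_eq_neg.1 q.2
      rw [mink_smul_right, mink_sub_right, mink_smul_right, h2, c.2.1,
        show -1 - a * -a = b * b by rw [hb2]; ring, ← mul_assoc, inv_mul_cancel₀ hb.ne', one_mul]
    -- The differential kills vectors tangent to the sphere, so being nonzero on the tangent space
    -- it is nonzero on the radial direction.
    have hfν : fderiv ℝ f p.1.1 (b⁻¹ • (c.1 - a • p.1.1)) ≠ 0 := by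
      intro h0
      set ν := b⁻¹ • (c.1 - a • p.1.1)
      have hcp : c.1 = a • p.1.1 + b • ν := by
        rw [smul_smul, mul_inv_cancel₀ hb.ne', one_smul]; abel
      have h1 : mink p.1.1 (v - mink v ν • ν) = 0 := by
        rw [mink_sub_right, mink_smul_right, hpv, (hν p).1]; ring
      have h2 : mink c.1 (v - mink v ν • ν) = 0 := by
        rw [hcp, mink_add_left, mink_smul_left, mink_smul_left, h1, mink_sub_right,
          mink_smul_right, (hν p).2, mink_comm ν v]
        ring
      have h3 := fderiv_eq_zero_of_subset_sphere hn hr hCa hp hU hpU hf hC h1 h2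
      rw [map_sub, map_smul, h0, smul_zero, sub_zero] at h3
      exact hfv h3
    have hψ : Continuous fun y : {x | height c x = a} × ℝ =>
        geodesic y.1.1 _ (hν y.1) y.2 := by
      have hfst : Continuous fun y : {x | height c x = a} × ℝ => y.1.1 :=
        continuous_subtype_val.comp continuous_fst
      exact continuous_geodesic (fun y => hν y.1) hfst
        ((continuous_const.sub ((continuous_val.comp hfst).const_smul a)).const_smul b⁻¹)
        continuous_snd
    have hρ := Real.arcosh_pos ha
    -- Radial geodesics from nearby `q` on the sphere meet `C` at some `|s| < arcosh a`. The height
    -- along them is `cosh (s - arcosh a)`, so they meet the sphere only at `s = 0` and at the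
    -- antipode `s = 2 arcosh a`, which the bound excludes. Hence `q ∈ C`.
    have hev := eventually_exists_mem hr hU hpU hf hp hC (x₀ := p) hψ
      (by simp only [geodesic_zero]) (hasDerivAt_geodesic_zero p.1 (hν p)) hfν hρ
    filter_upwards [hev] with q hq
    obtain ⟨s, hs, hsC⟩ := hq
    have h1 := hCa _ hsC
    rw [height_geodesic, hcν, show height c q.1 = a from q.2] at h1
    have h2 : Real.cosh (s - Real.arcosh a) = Real.cosh (Real.arcosh a) := by
      rw [Real.cosh_sub, Real.cosh_arcosh ha.le, Real.sinh_arcosh ha.le, ← hbdef]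
      exact h1
    have h3 : |s - Real.arcosh a| = |Real.arcosh a| :=
      le_antisymm (Real.cosh_le_cosh.1 h2.le) (Real.cosh_le_cosh.1 h2.ge)
    have h4 : s = 0 := by
      rw [abs_lt] at hs
      rw [abs_of_neg (by linarith), abs_of_pos hρ] at h3
      linarith
    subst h4
    rwa [geodesic_zero] at hsC
  have : PreconnectedSpace {x | height c x = a} :=
    Subtype.preconnectedSpace (isPreconnected_height_eq hn c a)
  obtain ⟨p, hp⟩ := hne
  have huniv := IsClopen.eq_univ ⟨hcl.preimage continuous_subtype_val, hopen⟩
    ⟨(⟨p, hCa p hp⟩ : {x | height c x = a}), hp⟩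
  intro x hx
  exact Set.eq_univ_iff_forall.1 huniv ⟨x, hx⟩

/-! ### From the union of spheres to a single sphere -/

instance : T2Space (HyperbolicSpace n) :=
  inferInstanceAs (T2Space {x : Fin (n + 1) → ℝ // mink x x = -1 ∧ 0 < x 0})

theorem interior_biUnion_eq_empty {X ι : Type*} [TopologicalSpace X] {C : ι → Set X}
    (hcl : ∀ i, IsClosed (C i)) (hint : ∀ i, interior (C i) = ∅) (s : Finset ι) :
    interior (⋃ i ∈ s, C i) = ∅ := by
  classical
  induction s using Finset.induction_on with
  | empty => simp
  | insert i s _ ih =>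
    rw [Finset.set_biUnion_insert, interior_union_isClosed_of_interior_empty (hcl i) ih, hint i]

/-- A connected subset of a union of spheres about `c` with empty interior lies in one of the
spheres. -/
theorem height_eq_of_mem {S C : Set (HyperbolicSpace n)} {c : HyperbolicSpace n}
    (hS : ∀ x ∈ S, ∀ y, height c x = height c y → y ∈ S) (hint : interior S = ∅)
    (hC : IsPreconnected C) (hCS : C ⊆ S) {x y : HyperbolicSpace n} (hx : x ∈ C) (hy : y ∈ C) :
    height c x = height c y := by
  wlog hlt : height c x < height c y generalizing x y
  · rcases lt_trichotomy (height c x) (height c y) with h | h | h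
    · exact this hx hy h
    · exact h
    · exact (this hy hx h).symm
  -- The heights on the connected set `C` fill an interval; saturation then puts the whole open
  -- shell between the two spheres into `S`.
  have hivt : ∀ t ∈ Set.Icc (height c x) (height c y), ∃ q ∈ C, height c q = t := fun t ht =>
    hC.intermediate_value hx hy (continuous_height c).continuousOn ht
  have hopen : IsOpen {q | height c x < height c q ∧ height c q < height c y} :=
    (isOpen_lt continuous_const (continuous_height c)).inter
      (isOpen_lt (continuous_height c) continuous_const)
  have hsub : {q | height c x < height c q ∧ height c q < height c y} ⊆ S := fun q hq => by
    obtain ⟨q', hq', h⟩ := hivt (height c q) ⟨hq.1.le, hq.2.le⟩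
    exact hS q' (hCS hq') q h
  obtain ⟨t, ht⟩ := exists_between hlt
  obtain ⟨q, -, rfl⟩ := hivt t ⟨ht.1.le, ht.2.le⟩
  have : q ∈ interior S := interior_maximal hsub hopen ht
  simp [hint] at this

theorem setOf_height_eq {c : HyperbolicSpace n} {a : ℝ} (ha : 1 < a) :
    {x | height c x = a} = geodesicSphere c (Real.arcosh a) := by
  ext x
  exact ⟨fun h => congrArg Real.arcosh h, fun h =>
    Real.arcosh_injOn (one_le_height c x) ha.le h⟩

end Hyperbolic

theorem mainTheorem7 {n : ℕ} (hn : 2 ≤ n) {r : WithTop ℕ∞} (hr : 1 ≤ r)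
    {k : ℕ} (hk : 1 ≤ k) (C : Fin k → Set (Hyperbolic.HyperbolicSpace n))
    (hconn : ∀ j, IsConnected (C j))
    (hclosed : ∀ j, IsCompact (C j))
    (hemb : ∀ j, Hyperbolic.IsEmbeddedHypersurface r (C j))
    (hdisj : ∀ i j, i ≠ j → ∀ D E : Set (Hyperbolic.HyperbolicSpace n),
      Hyperbolic.IsBoundedDomainOf D (C i) → Hyperbolic.IsBoundedDomainOf E (C j) →
        Disjoint D E)
    (hsym : ∀ γ : Set (Hyperbolic.HyperbolicSpace n), Hyperbolic.IsGeodesic γ →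
      ∃ π : Set (Hyperbolic.HyperbolicSpace n), Hyperbolic.IsGeodesicHyperplane π ∧
        Hyperbolic.IsOrthogonal π γ ∧ Hyperbolic.IsPlaneOfSymmetry π (⋃ j, C j)) :
    ∃ (c : Hyperbolic.HyperbolicSpace n) (ρ : ℝ), 0 < ρ ∧
      (⋃ j, C j) = Hyperbolic.geodesicSphere c ρ := by
  have hcl : ∀ j, IsClosed (C j) := fun j => (hclosed j).isClosed
  have hint : interior (⋃ j, C j) = ∅ := by
    simpa using Hyperbolic.interior_biUnion_eq_empty hcl
      (fun j => (hemb j).interior_eq_empty hr) Finset.univ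
  obtain ⟨p, hp⟩ := (hconn ⟨0, hk⟩).nonempty
  obtain ⟨c, hc⟩ := Hyperbolic.exists_center_saturated (isCompact_iUnion hclosed)
    ⟨p, Set.mem_iUnion.2 ⟨_, hp⟩⟩ hsym
  have hsphere : ∀ j, ∃ a, 1 < a ∧ C j = {x | Hyperbolic.height c x = a} := fun j => by
    obtain ⟨q, hq⟩ := (hconn j).nonempty
    exact ⟨_, Hyperbolic.eq_sphere_of_subset_sphere hn hr (hemb j) (hcl j) ⟨q, hq⟩ fun x hx =>
      Hyperbolic.height_eq_of_mem hc hint (hconn j).isPreconnected (Set.subset_iUnion C j) hx hq⟩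
  choose a ha hCa using hsphere
  -- The open balls bounded by two of the spheres both contain the common centre `c`.
  have hsub : ∀ j : Fin k, j = ⟨0, hk⟩ := fun j => by
    by_contra hj
    have hdom : ∀ i, Hyperbolic.IsBoundedDomainOf {x | Hyperbolic.height c x < a i} (C i) :=
      fun i => by rw [hCa i]; exact Hyperbolic.isBoundedDomainOf_ball hn c (ha i)
    have hmem : ∀ i, c ∈ {x | Hyperbolic.height c x < a i} := fun i => by
      change Hyperbolic.height c c < a i
      rw [Hyperbolic.height_self]; exact ha i
    exact Set.disjoint_left.1 (hdisj j _ hj _ _ (hdom j) (hdom _)) (hmem j) (hmem _)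
  refine ⟨c, Real.arcosh (a ⟨0, hk⟩), Real.arcosh_pos (ha _), ?_⟩
  rw [← Hyperbolic.setOf_height_eq (ha _), ← hCa]
  exact subset_antisymm (Set.iUnion_subset fun j => by rw [hsub j]) (Set.subset_iUnion C _)
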